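/- For a lattice $\Lambda\subset\mathbb{R}^n$ (a discrete subgroup spanning $\mathbb{R}^n$) let $\Theta_\Lambda(z)=\sum_{x\in\Lambda}e^{\pi i\|x\|^2z}$ for $\operatorname{Im} z>0$, and let its secrecy gain be $$\chi_\Lambda=\max_{y>0}\frac{\Theta_{\mathbb{Z}^n}(yi)}{\Theta_\Lambda(yi)} .$$ Call $\Lambda$ even unimodular if it has determinant $1$ (equivalently, covolume $1$) and $\|x\|^2\in 2\mathbb{Z}$ for all $x\in\Lambda$; by the length of a vector $x$ we mean $\|x\|^2$, and the shortest vector length of $\Lambda$ is $\min\{\|x\|^2 : x\in\Lambda,\ x\neq 0\}$. Let $n=24m+8k$ with integers $m\ge 0$ and $k\in\{0,1,2\}$. Let $\Lambda$ be an extremal even unimodular lattice in $\mathbb{R}^n$, that is, one with shortest vector length $2m+2$, and let $\Lambda'$ be any even unimodular lattice in $\mathbb{R}^n$ with shortest vector length $2m$. Then both secrecy gains exist (the maxima are attained), and $$\chi_\Lambda>\chi_{\Lambda'} .$$ -/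

import Mathlib

noncomputable section

namespace SecrecyGain

/-- Determinant `±1`, i.e. covolume `1` (the determinant of a Gram matrix is the square of the
covolume), and integral norms `‖x‖²`. -/
structure IsUnimodular {n : ℕ} (L : Submodule ℤ (EuclideanSpace ℝ (Fin n))) : Prop where
  covolume_eq_one : ZLattice.covolume L = 1
  integral_norm : ∀ x ∈ L, ∃ a : ℤ, ‖x‖ ^ 2 = (a : ℝ)

/-- All norms `‖x‖²` are even integers. By polarization all inner products are then integers. -/
def IsEven {n : ℕ} (L : Submodule ℤ (EuclideanSpace ℝ (Fin n))) : Prop :=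
  ∀ x ∈ L, ∃ a : ℤ, ‖x‖ ^ 2 = 2 * (a : ℝ)

/-- The shortest nonzero vectors of `L` have length `r`, where the length of a vector `x` is
its norm `‖x‖²`, as usual for unimodular lattices. -/
def HasShortestLength {n : ℕ} (L : Submodule ℤ (EuclideanSpace ℝ (Fin n))) (r : ℝ) : Prop :=
  IsLeast {t : ℝ | ∃ x ∈ L, x ≠ 0 ∧ ‖x‖ ^ 2 = t} r

/-- Extremality of an even unimodular lattice: the shortest length is `2 ⌊n / 24⌋ + 2`
(the division is the one of `ℕ`), which is `2 m + 2` when `n = 24 m + 8 k` with `k ≤ 2`. -/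
def IsExtremal {n : ℕ} (L : Submodule ℤ (EuclideanSpace ℝ (Fin n))) : Prop :=
  HasShortestLength L ((2 * (n / 24) + 2 : ℕ) : ℝ)

/-- The theta series `Θ_L(z) = ∑_{x ∈ L} exp(π i ‖x‖² z)`. -/
def theta {n : ℕ} (L : Submodule ℤ (EuclideanSpace ℝ (Fin n))) (z : ℂ) : ℂ :=
  ∑' x : L, Complex.exp (Real.pi * Complex.I * ((‖(x : EuclideanSpace ℝ (Fin n))‖ ^ 2 : ℝ) : ℂ) * z)

/-- On the imaginary axis the theta series is real, so nothing is lost by `re` below. -/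
theorem theta_mul_I {n : ℕ} (L : Submodule ℤ (EuclideanSpace ℝ (Fin n))) (y : ℝ) :
    theta L (y * Complex.I) =
      ((∑' x : L, Real.exp (-Real.pi * y * ‖(x : EuclideanSpace ℝ (Fin n))‖ ^ 2) : ℝ) : ℂ) := by
  rw [theta, Complex.ofReal_tsum]
  refine tsum_congr fun x => ?_
  rw [Complex.ofReal_exp]
  congr 1
  push_cast
  linear_combination
    ((Real.pi : ℂ) * y * (‖(x : EuclideanSpace ℝ (Fin n))‖ : ℂ) ^ 2) * Complex.I_mul_I

/-- The lattice `ℤⁿ`. -/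
def intLattice (n : ℕ) : Submodule ℤ (EuclideanSpace ℝ (Fin n)) :=
  Submodule.span ℤ (Set.range (EuclideanSpace.basisFun (Fin n) ℝ).toBasis)

/-- The secrecy function `Ξ_L(y) = Θ_{ℤⁿ}(y i) / Θ_L(y i)`. -/
def secrecyFunction {n : ℕ} (L : Submodule ℤ (EuclideanSpace ℝ (Fin n))) (y : ℝ) : ℝ :=
  (theta (intLattice n) (y * Complex.I) / theta L (y * Complex.I)).re

/-- `χ` is the secrecy gain of `L`: the maximum of the secrecy function over all `y > 0`. -/
def IsSecrecyGain {n : ℕ} (L : Submodule ℤ (EuclideanSpace ℝ (Fin n))) (χ : ℝ) : Prop :=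
  IsGreatest (secrecyFunction L '' Set.Ioi 0) χ

end SecrecyGain

end

/-! Both secrecy functions have the numerator `Θ_{ℤⁿ}`, so it suffices to show `Θ_Λ < Θ_Λ'` on the
whole positive imaginary axis and to compare at a maximiser for `Λ'`.

Both theta series are level-one modular forms of weight `n / 2 = 12 m + 4 k` of the shape `1 + O(q ^
m)`. Their difference is divisible by `Δ ^ m`, and the quotient has weight `4 k ≤ 8`, where the
space of forms is spanned by `E₄ ^ k`. Hence `Θ_Λ' - Θ_Λ = c Δ ^ m E₄ ^ k`
(`exists_theta_sub_theta_eq`). On the imaginary axis `Δ` and `E₄` are positive, so the difference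
has constant sign there; far up it is positive, because `Λ'` has vectors of norm `2 m` and `Λ` has
none (`exists_realTheta_lt`).

The maxima exist because the secrecy function is continuous, invariant under `y ↦ 1 / y`, tends to
`1` at infinity and exceeds `1` somewhere. The inversion formula, needed here and for modularity, is
Poisson summation together with self-duality of the lattice (`tsum_gaussian_eq`). -/

noncomputable section

namespace SecrecyGain

open Filter Topology Complex

variable {n : ℕ} (L : Submodule ℤ (EuclideanSpace ℝ (Fin n)))

/-! ### Convergence and decay of theta series -/

section Summability

variable [DiscreteTopology L]

/-- From `s ^ N / N! ≤ exp s`, the Gaussian is dominated by a multiple of `‖x‖ ^ (-2 N)`, which is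
summable once `2 N` exceeds the rank. -/
theorem summable_exp_neg_mul_norm_sq {c : ℝ} (hc : 0 < c) :
    Summable fun x : L ↦ Real.exp (-c * ‖(x : EuclideanSpace ℝ (Fin n))‖ ^ 2) := by
  set N : ℕ := Module.finrank ℤ L + 1
  have hs := (ZLattice.summable_norm_pow_inv L (2 * N) (by omega)).mul_left
    ((N.factorial : ℝ) / c ^ N)
  refine Summable.of_norm_bounded_eventually hs ?_
  have h0 : ({0} : Set L)ᶜ ∈ cofinite := (Set.finite_singleton (0 : L)).compl_mem_cofinite
  filter_upwards [h0] with x hx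
  have hx0 : 0 < ‖(x : EuclideanSpace ℝ (Fin n))‖ := by
    rw [norm_pos_iff]
    simpa using hx
  set t := ‖(x : EuclideanSpace ℝ (Fin n))‖ with ht
  have h1 := Real.pow_div_factorial_le_exp (c * t ^ 2) (by positivity) N
  rw [Real.norm_of_nonneg (Real.exp_pos _).le, neg_mul, Real.exp_neg, Submodule.coe_norm, ← ht]
  calc (Real.exp (c * t ^ 2))⁻¹ ≤ ((c * t ^ 2) ^ N / N.factorial)⁻¹ := by gcongr
    _ = _ := by rw [inv_div, mul_pow, ← pow_mul, inv_pow]; field_simp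

theorem norm_theta_term (v : EuclideanSpace ℝ (Fin n)) (z : ℂ) :
    ‖cexp (Real.pi * I * ((‖v‖ ^ 2 : ℝ) : ℂ) * z)‖ = Real.exp (-(Real.pi * z.im) * ‖v‖ ^ 2) := by
  rw [Complex.norm_exp]
  congr 1
  simp only [mul_re, mul_im, ofReal_re, ofReal_im, I_re, I_im]
  ring

theorem summable_theta_norm {z : ℂ} (hz : 0 < z.im) :
    Summable fun x : L ↦
      ‖cexp (Real.pi * I * ((‖(x : EuclideanSpace ℝ (Fin n))‖ ^ 2 : ℝ) : ℂ) * z)‖ := by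
  simp_rw [norm_theta_term]
  exact summable_exp_neg_mul_norm_sq L (by positivity)

theorem differentiableOn_theta : DifferentiableOn ℂ (theta L) {z | 0 < z.im} := by
  intro z hz
  have hz : 0 < z.im := hz
  have hopen : IsOpen {w : ℂ | z.im / 2 < w.im} := isOpen_lt continuous_const continuous_im
  refine DifferentiableAt.differentiableWithinAt ?_
  refine DifferentiableOn.differentiableAt (s := {w : ℂ | z.im / 2 < w.im}) ?_
    (hopen.mem_nhds (by simp only [Set.mem_ofPred_eq]; linarith))
  unfold theta
  refine differentiableOn_tsum_of_summable_norm
    (summable_exp_neg_mul_norm_sq L (c := Real.pi * (z.im / 2)) (by positivity))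
    (fun x ↦ by fun_prop) hopen fun x w hw ↦ ?_
  rw [norm_theta_term]
  have hw : z.im / 2 < w.im := hw
  gcongr

/-- A vector of norm at least `r` contributes at most `e^{-π r (y - 1)}` times its contribution
at height one. -/
theorem exp_le_exp_mul_exp {r y t : ℝ} (hy : 1 ≤ y) (ht : r ≤ t) :
    Real.exp (-(Real.pi * y) * t) ≤
      Real.exp (-(Real.pi * r * (y - 1))) * Real.exp (-Real.pi * t) := by
  rw [← Real.exp_add, Real.exp_le_exp]
  nlinarith [mul_nonneg (mul_nonneg Real.pi_pos.le (sub_nonneg.2 hy)) (sub_nonneg.2 ht)]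

/-- Every term except that of the zero vector gains the same exponential factor over height one. The
vanishing order at infinity and the limits along the imaginary axis come from this bound. -/
theorem norm_theta_sub_one_le {r : ℝ} (hr : ∀ x ∈ L, x ≠ 0 → r ≤ ‖x‖ ^ 2) {z : ℂ}
    (hz : 1 ≤ z.im) :
    ‖theta L z - 1‖ ≤ Real.exp (-(Real.pi * r * (z.im - 1))) *
      ∑' x : L, Real.exp (-Real.pi * ‖(x : EuclideanSpace ℝ (Fin n))‖ ^ 2) := by
  classical
  have hz0 : 0 < z.im := by linarith
  have hs := (summable_theta_norm L hz0).of_norm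
  have h1 : theta L z - 1 = ∑' x : L, if x = 0 then 0 else
      cexp (Real.pi * I * ((‖(x : EuclideanSpace ℝ (Fin n))‖ ^ 2 : ℝ) : ℂ) * z) := by
    rw [theta, hs.tsum_eq_add_tsum_ite 0]
    simp
  rw [h1, ← tsum_mul_left]
  refine tsum_of_norm_bounded ((summable_exp_neg_mul_norm_sq L Real.pi_pos).mul_left _).hasSum
    fun x ↦ ?_
  split_ifs with h
  · rw [norm_zero]; positivity
  · rw [norm_theta_term]
    exact exp_le_exp_mul_exp hz (hr x x.2 (by simpa using h))

end Summability

/-- The theta series on the imaginary axis, as a real function. -/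
def realTheta (y : ℝ) : ℝ :=
  ∑' x : L, Real.exp (-Real.pi * y * ‖(x : EuclideanSpace ℝ (Fin n))‖ ^ 2)

theorem theta_mul_I_eq (y : ℝ) : theta L (y * I) = (realTheta L y : ℂ) := theta_mul_I L y

theorem secrecyFunction_eq (y : ℝ) :
    secrecyFunction L y = realTheta (intLattice n) y / realTheta L y := by
  rw [secrecyFunction, theta_mul_I_eq, theta_mul_I_eq, ← ofReal_div, ofReal_re]

variable [DiscreteTopology L]

theorem one_add_exp_le_realTheta {y : ℝ} (hy : 0 < y) {v : EuclideanSpace ℝ (Fin n)} (hv : v ∈ L)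
    (hv0 : v ≠ 0) : 1 + Real.exp (-Real.pi * y * ‖v‖ ^ 2) ≤ realTheta L y := by
  classical
  have hs := summable_exp_neg_mul_norm_sq L (c := Real.pi * y) (by positivity)
  simp only [← neg_mul] at hs
  have hne : (0 : L) ≠ ⟨v, hv⟩ := fun h ↦ hv0 (congrArg Subtype.val h).symm
  have := hs.sum_le_tsum {0, ⟨v, hv⟩} fun _ _ ↦ (Real.exp_pos _).le
  rw [Finset.sum_pair hne] at this
  simpa [realTheta] using this

theorem one_le_realTheta {y : ℝ} (hy : 0 < y) : 1 ≤ realTheta L y := by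
  have hs := summable_exp_neg_mul_norm_sq L (c := Real.pi * y) (by positivity)
  simp only [← neg_mul] at hs
  simpa [realTheta] using hs.le_tsum 0 fun _ _ ↦ (Real.exp_pos _).le

theorem abs_realTheta_sub_one_le {r : ℝ} (hr : ∀ x ∈ L, x ≠ 0 → r ≤ ‖x‖ ^ 2) {y : ℝ}
    (hy : 1 ≤ y) :
    |realTheta L y - 1| ≤ Real.exp (-(Real.pi * r * (y - 1))) * realTheta L 1 := by
  have h := norm_theta_sub_one_le L hr (z := y * I) (by simpa using hy)
  rw [theta_mul_I_eq, ← ofReal_one, ← ofReal_sub, norm_real, Real.norm_eq_abs] at h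
  simpa [realTheta] using h

theorem continuousOn_realTheta : ContinuousOn (realTheta L) (Set.Ioi 0) := by
  have h : ContinuousOn (fun y : ℝ ↦ (theta L (y * I)).re) (Set.Ioi 0) := by
    refine continuous_re.comp_continuousOn ((differentiableOn_theta L).continuousOn.comp
      (by fun_prop) fun y hy ↦ ?_)
    simpa using hy
  simpa only [theta_mul_I_eq, ofReal_re] using h

end SecrecyGain

namespace SecrecyGain

open Filter Topology Complex MeasureTheory

/-! ### Poisson summation on the torus -/

section Poisson

variable {ι : Type*}

/-- The projection from `ℝ^ι` to the torus. -/
def toTorus (ι : Type*) : C(ι → ℝ, UnitAddTorus ι) where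
  toFun x i := (x i : UnitAddCircle)
  continuous_toFun := continuous_pi fun i ↦ (AddCircle.continuous_mk' 1).comp (continuous_apply i)

theorem toTorus_apply (x : ι → ℝ) : toTorus ι x = fun i ↦ (x i : UnitAddCircle) := rfl

theorem isQuotientMap_toTorus : IsQuotientMap (toTorus ι) :=
  (IsOpenQuotientMap.piMap (f := fun _ : ι ↦ ((↑) : ℝ → UnitAddCircle))
    fun _ ↦ QuotientAddGroup.isOpenQuotientMap_mk).isQuotientMap

/-- An integer vector as a real vector. -/
def intVec (k : ι → ℤ) : ι → ℝ := fun i ↦ (k i : ℝ)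

theorem intVec_add (k l : ι → ℤ) : intVec (k + l) = intVec k + intVec l := by
  ext i; simp [intVec]

theorem toTorus_add_intVec (x : ι → ℝ) (k : ι → ℤ) : toTorus ι (x + intVec k) = toTorus ι x := by
  ext i
  simp [toTorus_apply, intVec]

theorem exists_add_intVec_of_toTorus_eq {x y : ι → ℝ} (h : toTorus ι x = toTorus ι y) :
    ∃ k : ι → ℤ, y + intVec k = x := by
  have : ∀ i, ∃ k : ℤ, y i + k = x i := fun i ↦ by
    have hi : ((x i : ℝ) : UnitAddCircle) = (y i : ℝ) := congrFun h i
    rw [eq_comm, QuotientAddGroup.eq, AddSubgroup.mem_zmultiples_iff] at hi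
    obtain ⟨k, hk⟩ := hi
    exact ⟨k, by simp at hk; linarith⟩
  choose k hk using this
  exact ⟨k, funext hk⟩

variable [Fintype ι]

/-- The integer lattice in `ℝ^ι` as an additive group of integer vectors. -/
def intVecEquiv (ι : Type*) [Fintype ι] :
    (ι → ℤ) ≃ Submodule.span ℤ (Set.range (Pi.basisFun ℝ ι)) :=
  ((Pi.basisFun ℝ ι).restrictScalars ℤ).equivFun.symm.toEquiv

theorem coe_intVecEquiv (k : ι → ℤ) : (intVecEquiv ι k : ι → ℝ) = intVec k := by
  classical
  ext i
  simp [intVecEquiv, Module.Basis.equivFun_symm_apply, intVec, Finset.sum_apply, Pi.single_apply]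

/-- Unfolding an integral over `ℝ^ι` along the integer lattice. -/
theorem integral_eq_tsum_box {f : (ι → ℝ) → ℂ} (hf : Integrable f) :
    ∫ x, f x = ∑' k : ι → ℤ, ∫ x in {x : ι → ℝ | ∀ i, x i ∈ Set.Ioc (0 : ℝ) (0 + 1)},
      f (x + intVec k) := by
  let Γ := Submodule.span ℤ (Set.range (Pi.basisFun ℝ ι))
  have : MeasurableVAdd Γ (ι → ℝ) := (inferInstance : MeasurableVAdd Γ.toAddSubgroup (ι → ℝ))
  have : VAddInvariantMeasure Γ (ι → ℝ) volume :=
    (inferInstance : VAddInvariantMeasure Γ.toAddSubgroup (ι → ℝ) volume)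
  rw [(ZSpan.isAddFundamentalDomain (Pi.basisFun ℝ ι) volume).integral_eq_tsum'' f hf,
    ← (intVecEquiv ι).tsum_eq]
  refine tsum_congr fun k ↦ ?_
  rw [ZSpan.fundamentalDomain_pi_basisFun]
  have h1 : {x : ι → ℝ | ∀ i, x i ∈ Set.Ioc (0 : ℝ) (0 + 1)} =
      Set.univ.pi fun _ ↦ Set.Ioc (0 : ℝ) 1 := by
    ext x; simp [Set.mem_pi]
  -- The lattice's fundamental domain and the torus box are half-open on opposite sides; they differ
  -- by a null set.
  have h2 : (Set.univ.pi fun _ : ι ↦ Set.Ico (0 : ℝ) 1) =ᵐ[volume]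
      Set.univ.pi fun _ ↦ Set.Ioc (0 : ℝ) 1 :=
    Measure.univ_pi_Ico_ae_eq_Icc.trans Measure.univ_pi_Ioc_ae_eq_Icc.symm
  rw [h1, setIntegral_congr_set h2]
  refine setIntegral_congr_fun (MeasurableSet.univ_pi fun _ ↦ measurableSet_Ioc) fun x _ ↦ ?_
  simp only [Submodule.vadd_def, vadd_eq_add, coe_intVecEquiv, add_comm]

/-- **Poisson summation** for the integer lattice of `ℝ^ι`. -/
theorem tsum_intVec_eq_tsum_integral {f : (ι → ℝ) → ℂ} (hf : Continuous f) (hfi : Integrable f)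
    (hloc : ∀ R : ℝ, ∃ u : (ι → ℤ) → ℝ, Summable u ∧ ∀ k, ∀ x : ι → ℝ, ‖x‖ ≤ R →
      ‖f (x + intVec k)‖ ≤ u k)
    (hs : Summable fun k : ι → ℤ ↦ ∫ x, UnitAddTorus.mFourier (-k) (toTorus ι x) * f x) :
    ∑' k : ι → ℤ, f (intVec k) =
      ∑' k : ι → ℤ, ∫ x, UnitAddTorus.mFourier (-k) (toTorus ι x) * f x := by
  have hcont : Continuous fun x ↦ ∑' k : ι → ℤ, f (x + intVec k) := by
    refine continuous_iff_continuousAt.2 fun x ↦ ?_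
    obtain ⟨u, hu, hub⟩ := hloc (‖x‖ + 1)
    refine ContinuousOn.continuousAt (s := Metric.ball 0 (‖x‖ + 1)) ?_
      (Metric.isOpen_ball.mem_nhds (by simp))
    exact continuousOn_tsum (fun k ↦ by fun_prop) hu
      fun k y hy ↦ hub k y (by simpa using (Metric.mem_ball.1 hy).le)
  -- The periodization of `f` descends to the torus; its Fourier coefficients unfold to Fourier
  -- integrals of `f`, and its Fourier series is evaluated at `0`.
  let F : C(ι → ℝ, ℂ) := ⟨_, hcont⟩
  have hF : Function.FactorsThrough F (toTorus ι) := fun x y hxy ↦ by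
    obtain ⟨k, rfl⟩ := exists_add_intVec_of_toTorus_eq hxy
    change ∑' l : ι → ℤ, f (y + intVec k + intVec l) = ∑' l : ι → ℤ, f (y + intVec l)
    rw [← (Equiv.addLeft k).tsum_eq fun l ↦ f (y + intVec l)]
    simp [intVec_add, add_assoc]
  let G : C(UnitAddTorus ι, ℂ) := isQuotientMap_toTorus.lift F hF
  have hG (x : ι → ℝ) : G (toTorus ι x) = ∑' k : ι → ℤ, f (x + intVec k) :=
    congrArg (fun g : C(ι → ℝ, ℂ) ↦ g x) (isQuotientMap_toTorus.lift_comp F hF)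
  have hcoeff (k : ι → ℤ) : UnitAddTorus.mFourierCoeff G k =
      ∫ x, UnitAddTorus.mFourier (-k) (toTorus ι x) * f x := by
    have hnorm (t : UnitAddTorus ι) : ‖UnitAddTorus.mFourier (-k) t‖ ≤ 1 :=
      ((UnitAddTorus.mFourier (-k)).norm_coe_le_norm t).trans UnitAddTorus.mFourier_norm.le
    have hint : Integrable fun x ↦ UnitAddTorus.mFourier (-k) (toTorus ι x) * f x := by
      refine hfi.bdd_mul (c := 1) (by fun_prop) (Eventually.of_forall fun x ↦ hnorm _)
    rw [integral_eq_tsum_box hint, UnitAddTorus.mFourierCoeff_eq_integral _ _ 0]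
    simp only [Pi.zero_apply, toTorus_add_intVec]
    set B := {x : ι → ℝ | ∀ i, x i ∈ Set.Ioc (0 : ℝ) (0 + 1)} with hB
    have hBmeas : MeasurableSet B := by
      have : B = Set.univ.pi fun _ ↦ Set.Ioc (0 : ℝ) (0 + 1) := by ext x; simp [hB, Set.mem_pi]
      rw [this]
      exact MeasurableSet.univ_pi fun _ ↦ measurableSet_Ioc
    have hBnorm : ∀ x ∈ B, ‖x‖ ≤ 1 := fun x hx ↦ by
      refine (pi_norm_le_iff_of_nonneg zero_le_one).2 fun i ↦ ?_
      have := hx i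
      rw [Real.norm_eq_abs, abs_of_pos this.1]
      linarith [this.2]
    have hBfin : volume B < ⊤ :=
      (Metric.isBounded_closedBall (x := (0 : ι → ℝ)) (r := 1)).measure_lt_top.trans_le' <|
        measure_mono fun x hx ↦ by simpa using hBnorm x hx
    have hintl (l : ι → ℤ) : Integrable
        (fun x ↦ UnitAddTorus.mFourier (-k) (toTorus ι x) * f (x + intVec l)) (volume.restrict B) := by
      refine Integrable.restrict ?_
      simpa only [toTorus_add_intVec] using hint.comp_add_right (intVec l)
    rw [integral_tsum_of_summable_integral_norm hintl]
    · refine setIntegral_congr_fun hBmeas fun x _ ↦ ?_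
      have := hG x
      rw [toTorus_apply] at this
      simp only [smul_eq_mul, this, tsum_mul_left, toTorus_apply]
    · obtain ⟨u, hu, hub⟩ := hloc 1
      refine Summable.of_nonneg_of_le (fun l ↦ integral_nonneg fun _ ↦ norm_nonneg _) (fun l ↦ ?_)
        (hu.mul_right (volume.real B))
      refine (Real.le_norm_self _).trans (norm_setIntegral_le_of_norm_le_const hBfin fun x hx ↦ ?_)
      rw [norm_norm, norm_mul]
      exact (mul_le_of_le_one_left (norm_nonneg _) (hnorm _)).trans (hub l x (hBnorm x hx))
  have hsum : Summable (UnitAddTorus.mFourierCoeff G) := by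
    rw [show UnitAddTorus.mFourierCoeff G = _ from funext hcoeff]
    exact hs
  have h0 := (UnitAddTorus.hasSum_mFourier_series_apply_of_summable hsum (toTorus ι 0)).tsum_eq
  rw [hG] at h0
  simp only [zero_add] at h0
  rw [← h0]
  refine tsum_congr fun k ↦ ?_
  rw [← hcoeff]
  simp [UnitAddTorus.mFourier, toTorus_apply]

end Poisson

end SecrecyGain

namespace SecrecyGain

open Filter Topology Complex MeasureTheory

open scoped FourierTransform Matrix

/-! ### Self-duality and the inversion formula -/

section Unimodular

variable {n : ℕ} {L : Submodule ℤ (EuclideanSpace ℝ (Fin n))}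

theorem exists_inner_eq_int (hL : IsEven L) {x y : EuclideanSpace ℝ (Fin n)} (hx : x ∈ L)
    (hy : y ∈ L) : ∃ a : ℤ, inner ℝ x y = (a : ℝ) := by
  obtain ⟨a, ha⟩ := hL x hx
  obtain ⟨b, hb⟩ := hL y hy
  obtain ⟨c, hc⟩ := hL (x + y) (L.add_mem hx hy)
  rw [norm_add_sq_real] at hc
  exact ⟨c - a - b, by push_cast; linarith⟩

theorem volume_real_fundamentalDomain_basisFun :
    volume.real (ZSpan.fundamentalDomain (EuclideanSpace.basisFun (Fin n) ℝ).toBasis) = 1 := by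
  rw [measureReal_congr (ZSpan.fundamentalDomain_ae_parallelepiped _ volume), measureReal_def,
    OrthonormalBasis.coe_toBasis, OrthonormalBasis.volume_parallelepiped, ENNReal.toReal_one]

theorem coe_equivFun_symm (b : Module.Basis (Fin n) ℤ L) (k : Fin n → ℤ) :
    ((b.equivFun.symm k : L) : EuclideanSpace ℝ (Fin n)) =
    ∑ i, (k i : ℝ) • (b i : EuclideanSpace ℝ (Fin n)) := by
  simp [Module.Basis.equivFun_symm_apply, Int.cast_smul_eq_zsmul]

/-- Dominates translated Gaussians uniformly for bounded `w`, as the periodization requires. -/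
theorem half_norm_sq_sub_le (v w : EuclideanSpace ℝ (Fin n)) :
    ‖v‖ ^ 2 / 2 - ‖w‖ ^ 2 ≤ ‖w + v‖ ^ 2 := by
  have h : ‖v‖ ≤ ‖w + v‖ + ‖w‖ := by simpa using norm_sub_le (w + v) w
  nlinarith [norm_nonneg v, norm_nonneg w, norm_nonneg (w + v), sq_nonneg (‖w + v‖ - ‖w‖)]

theorem mFourier_neg_toTorus {ι : Type*} [Fintype ι] (k : ι → ℤ) (x : ι → ℝ) :
    UnitAddTorus.mFourier (-k) (toTorus ι x) =
      cexp (((-2 * Real.pi * ∑ i, (k i : ℝ) * x i : ℝ) : ℂ) * I) := by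
  simp only [UnitAddTorus.mFourier, ContinuousMap.coe_mk, toTorus_apply, fourier_coe_apply,
    ← Complex.exp_sum]
  congr 1
  push_cast
  rw [Finset.mul_sum, Finset.sum_mul]
  refine Finset.sum_congr rfl fun i _ ↦ ?_
  simp
  ring

variable [DiscreteTopology L] [IsZLattice ℝ L]

variable (L) in
/-- A `ℤ`-basis of a lattice in `ℝⁿ`, indexed by `Fin n`. -/
def latticeBasis : Module.Basis (Fin n) ℤ L :=
  haveI : Module.Free ℤ L := ZLattice.module_free ℝ L
  haveI : Module.Finite ℤ L := ZLattice.module_finite ℝ L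
  Module.finBasisOfFinrankEq ℤ L (by rw [ZLattice.rank ℝ L, finrank_euclideanSpace_fin])

variable (b : Module.Basis (Fin n) ℤ L)

/-- The coordinates of a basis of a lattice of covolume one form a matrix whose Gram matrix has
determinant one. -/
theorem det_gram_eq_one (hL : ZLattice.covolume L = 1) :
    (Matrix.of fun i j ↦ (inner ℝ (b i : EuclideanSpace ℝ (Fin n)) (b j) : ℝ)).det = 1 := by
  have h1 := ZLattice.covolume_eq_det_mul_measureReal L volume b
    (EuclideanSpace.basisFun (Fin n) ℝ).toBasis
  rw [hL, volume_real_fundamentalDomain_basisFun, mul_one, Module.Basis.det_apply] at h1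
  set A := (EuclideanSpace.basisFun (Fin n) ℝ).toBasis.toMatrix (Subtype.val ∘ b) with hA
  have h2 : (Matrix.of fun i j ↦ (inner ℝ (b i : EuclideanSpace ℝ (Fin n)) (b j) : ℝ)) =
      Aᵀ * A := by
    ext i j
    simp only [Matrix.of_apply, Matrix.mul_apply, Matrix.transpose_apply, hA,
      Module.Basis.toMatrix_apply, OrthonormalBasis.coe_toBasis_repr_apply, Function.comp,
      EuclideanSpace.basisFun_repr, PiLp.inner_apply, RCLike.inner_apply, conj_trivial]
    exact Finset.sum_congr rfl fun _ _ ↦ mul_comm _ _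
  rw [h2, Matrix.det_mul, Matrix.det_transpose, ← sq, ← sq_abs, ← h1, one_pow]

/-- An integral lattice of covolume one is self-dual: pairing with a basis identifies the lattice
with the integer vectors. -/
theorem exists_dual_equiv (hL : ZLattice.covolume L = 1)
    (hint : ∀ x ∈ L, ∀ y ∈ L, ∃ a : ℤ, inner ℝ x y = (a : ℝ)) :
    ∃ e : L ≃ (Fin n → ℤ), ∀ (w : L) (i : Fin n),
      (e w i : ℝ) = inner ℝ (w : EuclideanSpace ℝ (Fin n)) (b i) := by
  choose M hM using fun i j ↦ hint (b i) (b i).2 (b j) (b j).2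
  have hdet : (Matrix.of M).det = 1 := by
    have h := det_gram_eq_one b hL
    have : (Matrix.of fun i j ↦ (inner ℝ (b i : EuclideanSpace ℝ (Fin n)) (b j) : ℝ)) =
        (Matrix.of M).map (Int.castRingHom ℝ) := by
      ext i j
      simp [hM]
    rw [this, ← RingHom.mapMatrix_apply, ← RingHom.map_det, eq_intCast] at h
    exact_mod_cast h
  -- The Gram matrix is integral of determinant one, so its inverse is integral too and it permutes
  -- `ℤⁿ`.
  have hunit : IsUnit (Matrix.of M).det := by rw [hdet]; exact isUnit_one
  let e₁ : (Fin n → ℤ) ≃ (Fin n → ℤ) :=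
    { toFun := fun k ↦ k ᵥ* Matrix.of M
      invFun := fun k ↦ k ᵥ* (Matrix.of M)⁻¹
      left_inv := fun k ↦ by
        simp only [Matrix.vecMul_vecMul, Matrix.mul_nonsing_inv _ hunit, Matrix.vecMul_one]
      right_inv := fun k ↦ by
        simp only [Matrix.vecMul_vecMul, Matrix.nonsing_inv_mul _ hunit, Matrix.vecMul_one] }
  refine ⟨b.equivFun.toEquiv.trans e₁, fun w j ↦ ?_⟩
  have hw : (w : EuclideanSpace ℝ (Fin n)) =
      ∑ i, ((b.equivFun w i : ℤ) : ℝ) • (b i : EuclideanSpace ℝ (Fin n)) := by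
    rw [← coe_equivFun_symm, LinearEquiv.symm_apply_apply]
  rw [hw, sum_inner]
  simp only [inner_smul_left, hM]
  simp [e₁, Matrix.vecMul, dotProduct]

/-- The coordinates of a lattice of covolume one preserve the volume. -/
theorem measurePreserving_equivFun (hL : ZLattice.covolume L = 1) :
    MeasurePreserving (b.ofZLatticeBasis ℝ L).equivFun.toContinuousLinearEquiv := by
  refine ⟨(ContinuousLinearEquiv.continuous _).measurable, Measure.ext fun s hs ↦ ?_⟩
  rw [Measure.map_apply (ContinuousLinearEquiv.continuous _).measurable hs]
  have hs' : MeasurableSet ((b.ofZLatticeBasis ℝ L).equivFun.toContinuousLinearEquiv ⁻¹' s) :=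
    (ContinuousLinearEquiv.continuous _).measurable hs
  have h := ZLattice.volume_image_eq_volume_div_covolume' L b hs'.nullMeasurableSet
  rw [hL, ENNReal.ofReal_one, div_one] at h
  rw [← h]
  congr 1
  exact (b.ofZLatticeBasis ℝ L).equivFun.toEquiv.image_preimage s

/-- Poisson summation of a Gaussian over an integral lattice of covolume one. -/
theorem tsum_gaussian_eq (hL : ZLattice.covolume L = 1)
    (hint : ∀ x ∈ L, ∀ y ∈ L, ∃ a : ℤ, inner ℝ x y = (a : ℝ)) {c : ℂ} (hc : 0 < c.re) :
    ∑' x : L, cexp (-c * ‖(x : EuclideanSpace ℝ (Fin n))‖ ^ 2) =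
      (Real.pi / c) ^ (n / 2 : ℂ) *
        ∑' x : L, cexp (-Real.pi ^ 2 * ‖(x : EuclideanSpace ℝ (Fin n))‖ ^ 2 / c) := by
  set b := latticeBasis L
  set φ := (b.ofZLatticeBasis ℝ L).equivFun.toContinuousLinearEquiv with hφ
  have hmp := measurePreserving_equivFun b hL
  have hmps : MeasurePreserving φ.symm :=
    hmp.symm (φ.toHomeomorph.toMeasurableEquiv)
  obtain ⟨e, he⟩ := exists_dual_equiv b hL hint
  set g : EuclideanSpace ℝ (Fin n) → ℂ := fun v ↦ cexp (-c * ‖v‖ ^ 2) with hg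
  have hφx (x : Fin n → ℝ) : φ.symm x = ∑ i, x i • (b i : EuclideanSpace ℝ (Fin n)) := by
    rw [hφ]
    simp [Module.Basis.equivFun_symm_apply]
  have hφk (k : Fin n → ℤ) : φ.symm (intVec k) = (b.equivFun.symm k : L) := by
    rw [hφx, coe_equivFun_symm]
    rfl
  have hgnorm (v : EuclideanSpace ℝ (Fin n)) : ‖g v‖ = Real.exp (-c.re * ‖v‖ ^ 2) := by
    rw [hg, Complex.norm_exp]
    congr 1
    rw [← ofReal_pow, re_mul_ofReal, neg_re]
  have hgi : Integrable g := by
    simpa [hg] using GaussianFourier.integrable_cexp_neg_mul_sq_norm_add hc 0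
      (0 : EuclideanSpace ℝ (Fin n))
  have hgf : Integrable fun x ↦ g (φ.symm x) :=
    (hmps.integrable_comp_emb φ.symm.toHomeomorph.measurableEmbedding).2 hgi
  have hloc (R : ℝ) : ∃ u : (Fin n → ℤ) → ℝ, Summable u ∧ ∀ k, ∀ x : Fin n → ℝ, ‖x‖ ≤ R →
      ‖g (φ.symm (x + intVec k))‖ ≤ u k := by
    set C := ‖(φ.symm : (Fin n → ℝ) →L[ℝ] EuclideanSpace ℝ (Fin n))‖
    -- Half of the Gaussian decay survives a shift of norm at most `C * R`, at the cost of a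
    -- constant factor.
    refine ⟨fun k ↦ Real.exp (c.re * (C * R) ^ 2) *
      Real.exp (-(c.re / 2) * ‖((b.equivFun.symm k : L) : EuclideanSpace ℝ (Fin n))‖ ^ 2),
      ((b.equivFun.symm.toEquiv.summable_iff).2
        (summable_exp_neg_mul_norm_sq L (half_pos hc))).mul_left _, fun k x hx ↦ ?_⟩
    have hx' : ‖φ.symm x‖ ≤ C * R :=
      ((φ.symm : (Fin n → ℝ) →L[ℝ] EuclideanSpace ℝ (Fin n)).le_opNorm x).trans (by gcongr)
    beta_reduce
    rw [hgnorm, ← Real.exp_add, Real.exp_le_exp, map_add, hφk]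
    have h1 := half_norm_sq_sub_le ((b.equivFun.symm k : L) : EuclideanSpace ℝ (Fin n)) (φ.symm x)
    have h2 : ‖φ.symm x‖ ^ 2 ≤ (C * R) ^ 2 := by gcongr
    nlinarith
  -- The integer frequency `e w` is the linear form `⟨·, w⟩` in lattice coordinates, and `φ`
  -- preserves volume, so this is the Fourier transform of the Gaussian at `w`.
  have hcoeff (w : L) : ∫ x, UnitAddTorus.mFourier (-(e w)) (toTorus (Fin n) x) * g (φ.symm x) =
      (Real.pi / c) ^ (n / 2 : ℂ) *
        cexp (-Real.pi ^ 2 * ‖(w : EuclideanSpace ℝ (Fin n))‖ ^ 2 / c) := by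
    have h := fourier_gaussian_innerProductSpace hc (w : EuclideanSpace ℝ (Fin n))
    rw [finrank_euclideanSpace_fin, Real.fourier_eq'] at h
    rw [← h, ← hmps.integral_comp φ.symm.toHomeomorph.measurableEmbedding]
    refine integral_congr_ae (Eventually.of_forall fun x ↦ ?_)
    have hsum : ∑ i, (e w i : ℝ) * x i =
        inner ℝ (φ.symm x) (w : EuclideanSpace ℝ (Fin n)) := by
      rw [real_inner_comm, hφx, inner_sum]
      exact Finset.sum_congr rfl fun i _ ↦ by rw [he, inner_smul_right, mul_comm]
    simp only [smul_eq_mul]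
    rw [mFourier_neg_toTorus, hsum]
  have hnorm2 : Summable fun w : L ↦ (Real.pi / c) ^ (n / 2 : ℂ) *
      cexp (-Real.pi ^ 2 * ‖(w : EuclideanSpace ℝ (Fin n))‖ ^ 2 / c) := by
    refine Summable.mul_left _ (Summable.of_norm ?_)
    have hc' : 0 < Real.pi ^ 2 * (c⁻¹).re := by
      have : c ≠ 0 := fun h ↦ by simp [h] at hc
      rw [inv_re]
      have := normSq_pos.2 this
      positivity
    refine (summable_exp_neg_mul_norm_sq L hc').congr fun w ↦ ?_
    rw [Complex.norm_exp]
    congr 1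
    rw [div_eq_mul_inv, ← ofReal_pow, ← ofReal_pow, ← ofReal_neg, ← ofReal_mul, re_ofReal_mul]
    ring
  have hP := tsum_intVec_eq_tsum_integral (f := fun x ↦ g (φ.symm x)) (by fun_prop) hgf hloc
    (by
      rw [← e.summable_iff]
      exact hnorm2.congr fun w ↦ (hcoeff w).symm)
  calc ∑' x : L, cexp (-c * ‖(x : EuclideanSpace ℝ (Fin n))‖ ^ 2)
      = ∑' k : Fin n → ℤ, g (φ.symm (intVec k)) := by
        rw [← b.equivFun.symm.toEquiv.tsum_eq]
        exact tsum_congr fun k ↦ by rw [hφk]; rfl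
    _ = _ := hP
    _ = _ := (e.tsum_eq _).symm.trans (tsum_congr hcoeff)
    _ = _ := tsum_mul_left

/-- The inversion formula for the theta series of an integral lattice of covolume one. -/
theorem theta_eq_cpow_mul_theta (hL : ZLattice.covolume L = 1)
    (hint : ∀ x ∈ L, ∀ y ∈ L, ∃ a : ℤ, inner ℝ x y = (a : ℝ)) {z : ℂ} (hz : 0 < z.im) :
    theta L z = (I / z) ^ (n / 2 : ℂ) * theta L (-1 / z) := by
  have hz0 : z ≠ 0 := fun h ↦ by simp [h] at hz
  have hpi : (Real.pi : ℂ) ≠ 0 := ofReal_ne_zero.2 Real.pi_ne_zero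
  have h := tsum_gaussian_eq hL hint (c := -(Real.pi * I * z)) (by
    simp only [neg_re, mul_re, mul_im, ofReal_re, ofReal_im, I_re, I_im]
    nlinarith [mul_pos Real.pi_pos hz])
  have h1 : (Real.pi : ℂ) / -(Real.pi * I * z) = I / z := by
    field_simp
    simp
  rw [h1] at h
  convert h using 1
  · exact tsum_congr fun x ↦ by congr 1; push_cast; ring
  · congr 1
    refine tsum_congr fun x ↦ ?_
    congr 1
    push_cast
    field_simp
    linear_combination (-(‖(x : EuclideanSpace ℝ (Fin n))‖ : ℂ) ^ 2) * I_sq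

theorem realTheta_inv (hL : ZLattice.covolume L = 1)
    (hint : ∀ x ∈ L, ∀ y ∈ L, ∃ a : ℤ, inner ℝ x y = (a : ℝ)) {y : ℝ} (hy : 0 < y) :
    realTheta L y = y⁻¹ ^ (n / 2 : ℝ) * realTheta L y⁻¹ := by
  have h := theta_eq_cpow_mul_theta hL hint (z := y * I) (by simpa using hy)
  have hy0 : (y : ℂ) ≠ 0 := ofReal_ne_zero.2 hy.ne'
  have h1 : -1 / ((y : ℂ) * I) = (y⁻¹ : ℝ) * I := by
    push_cast
    field_simp
    simp
  have h2 : I / ((y : ℂ) * I) = (y⁻¹ : ℝ) := by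
    push_cast
    field_simp
  have h3 : (n / 2 : ℂ) = ((n / 2 : ℝ) : ℂ) := by push_cast; rfl
  rw [h1, h2, theta_mul_I_eq, theta_mul_I_eq, h3, ← ofReal_cpow (by positivity)] at h
  exact_mod_cast h

end Unimodular

end SecrecyGain

namespace SecrecyGain

open Filter Topology Complex Asymptotics MatrixGroups ModularForm

open UpperHalfPlane hiding I

/-! ### Theta series as modular forms -/

section ModularForms

variable {n : ℕ} {L : Submodule ℤ (EuclideanSpace ℝ (Fin n))}

theorem theta_add_one (hL : IsEven L) (z : ℂ) : theta L (z + 1) = theta L z := by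
  refine tsum_congr fun x ↦ ?_
  obtain ⟨a, ha⟩ := hL x x.2
  rw [ha, Complex.exp_eq_exp_iff_exists_int]
  exact ⟨a, by push_cast; ring⟩

theorem theta_slash_T (hL : IsEven L) (w : ℤ) :
    (fun τ : ℍ ↦ theta L τ) ∣[w] ModularGroup.T = fun τ : ℍ ↦ theta L τ := by
  ext τ
  rw [SL_slash_apply, modular_T_smul, ModularGroup.denom_apply]
  simp [add_comm (1 : ℂ), theta_add_one hL, ModularGroup.T]

variable [DiscreteTopology L]

theorem theta_sub_one_isBigO {m : ℕ} (hr : ∀ x ∈ L, x ≠ 0 → 2 * (m : ℝ) ≤ ‖x‖ ^ 2) :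
    (fun τ : ℍ ↦ theta L τ - 1) =O[atImInfty] fun τ ↦ Real.exp (-2 * Real.pi * τ.im) ^ m := by
  refine IsBigO.of_bound (Real.exp (2 * Real.pi * m) * realTheta L 1) ?_
  filter_upwards [(atImInfty_mem _).2 ⟨1, fun τ hτ ↦ hτ⟩] with τ hτ
  refine (norm_theta_sub_one_le L hr (z := τ) hτ).trans_eq ?_
  rw [Real.norm_of_nonneg (by positivity), ← Real.exp_nat_mul,
    mul_right_comm (Real.exp (2 * Real.pi * m)), ← Real.exp_add, realTheta, mul_one]
  congr 2
  rw [coe_im]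
  ring

variable [IsZLattice ℝ L]

theorem theta_slash_S (hL : IsUnimodular L) (hLe : IsEven L) {j : ℕ} (hn : n = 8 * j) :
    (fun τ : ℍ ↦ theta L τ) ∣[((4 * j : ℕ) : ℤ)] ModularGroup.S = fun τ : ℍ ↦ theta L τ := by
  ext τ
  have h := theta_eq_cpow_mul_theta hL.covolume_eq_one
    (fun x hx y hy ↦ exists_inner_eq_int hLe hx hy) τ.im_pos
  have h1 : (n / 2 : ℂ) = ((4 * j : ℕ) : ℂ) := by
    rw [hn]
    push_cast
    ring
  -- Divisibility of `n` by `8` makes the exponent `4 j`, so the power of `I` disappears.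
  rw [h1, cpow_natCast, div_pow, pow_mul, I_pow_four, one_pow] at h
  rw [SL_slash_apply, modular_S_smul, ModularGroup.denom_S]
  simp only [zpow_neg, zpow_natCast]
  rw [h, mul_comm, one_div]
  congr 2
  simp [neg_div, inv_neg]

/-- The theta series of an even unimodular lattice in dimension `8 j`, as a modular form. -/
def thetaForm (hL : IsUnimodular L) (hLe : IsEven L) {j : ℕ} (hn : n = 8 * j) :
    ModularForm 𝒮ℒ ((4 * j : ℕ) : ℤ) where
  toFun τ := theta L τ
  slash_action_eq' A hA := by
    obtain ⟨A, rfl⟩ := hA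
    exact SlashInvariantForm.slash_action_generators_SL2Z (theta_slash_S hL hLe hn)
      (theta_slash_T hLe _) A
  holo' := by
    rw [UpperHalfPlane.mdifferentiable_iff]
    refine (differentiableOn_theta L).congr fun z hz ↦ ?_
    simp [ofComplex_apply_of_im_pos hz]
  bdd_at_cusps' hc := by
    rw [Subgroup.IsArithmetic.isCusp_iff_isCusp_SL2Z] at hc
    rw [OnePoint.isBoundedAt_iff_forall_SL2Z hc]
    intro γ _
    rw [SlashInvariantForm.slash_action_generators_SL2Z (theta_slash_S hL hLe hn)
        (theta_slash_T hLe _),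
      isBoundedAtImInfty_iff]
    refine ⟨1 + realTheta L 1, 1, fun τ hτ ↦ ?_⟩
    have h := norm_theta_sub_one_le L (r := 0) (fun x _ _ ↦ by positivity) (z := τ) hτ
    have h2 := norm_add_le (theta L τ - 1) 1
    rw [sub_add_cancel, norm_one] at h2
    simp only [mul_zero, zero_mul, neg_zero, Real.exp_zero, one_mul] at h
    rw [realTheta, mul_one]
    linarith

end ModularForms

/-! ### Division by powers of the discriminant -/

section Division

/-- A level-one form vanishing to order `m` at infinity is divisible by `Δ ^ m`. -/
theorem exists_eq_discriminant_pow_mul (m : ℕ) {w : ℤ} (f : ModularForm 𝒮ℒ (w + 12 * m))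
    (hf : f =O[atImInfty] fun τ ↦ Real.exp (-2 * Real.pi * τ.im) ^ m) :
    ∃ g : ModularForm 𝒮ℒ w, ∀ τ, f τ = discriminant τ ^ m * g τ := by
  induction m with
  | zero => exact ⟨f.mcast (by simp), fun τ ↦ by simp⟩
  | succ m ih =>
    have hexp : Tendsto (fun τ : ℍ ↦ Real.exp (-2 * Real.pi * τ.im)) atImInfty (𝓝 0) := by
      refine Real.tendsto_exp_atBot.comp ?_
      exact tendsto_comap.const_mul_atTop_of_neg (by linarith [Real.pi_pos])
    have hzero : IsZeroAtImInfty f :=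
      hf.trans_tendsto (by simpa using hexp.pow (m + 1))
    let F : CuspForm 𝒮ℒ (w + 12 * (m + 1 : ℕ)) :=
      { f with
        zero_at_cusps' := fun hc ↦ by
          rw [Subgroup.IsArithmetic.isCusp_iff_isCusp_SL2Z] at hc
          rw [OnePoint.isZeroAt_iff_forall_SL2Z hc]
          intro γ _
          have := f.slash_action_eq' γ ⟨γ, rfl⟩
          simp only [SL_slash] at this ⊢
          erw [this]
          exact hzero }
    have hF (τ : ℍ) : F τ = f τ := rfl
    -- Since `q = O(Δ)`, dividing by `Δ` costs exactly one order of vanishing, and it lowers the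
    -- weight by `12`.
    obtain ⟨g, hg⟩ := ih (f := (CuspForm.discriminantEquiv F).mcast (by push_cast; ring)) (by
      have h1 := hf.mul (exp_isBigO_discriminant.inv_rev
        (Eventually.of_forall fun τ h ↦ absurd h (Real.exp_pos _).ne'))
      refine h1.congr (fun τ ↦ ?_) fun τ ↦ ?_
      · exact (div_eq_mul_inv _ _).symm
      · rw [pow_succ, mul_inv_cancel_right₀ (Real.exp_pos _).ne'])
    refine ⟨g, fun τ ↦ ?_⟩
    have h1 := discriminant_mul_discriminantEquiv_apply F τ
    rw [← hF, ← h1, pow_succ', mul_assoc, ← hg]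
    rfl

end Division

/-! ### Positivity on the imaginary axis and forms of small weight -/

section ImaginaryAxis

theorem exp_two_pi_I_mul_I (y : ℝ) :
    cexp (2 * Real.pi * I * (y * I)) = (Real.exp (-2 * Real.pi * y) : ℝ) := by
  rw [ofReal_exp]
  congr 1
  push_cast
  linear_combination (2 * Real.pi * y : ℂ) * I_sq

/-- Here `q = exp (-2 π y)` is positive and the `q`-expansion has nonnegative coefficients; `240 =
-8 / B₄`. -/
theorem exists_E₄_eq_ofReal_pos {τ : ℍ} {y : ℝ} (hτ : (τ : ℂ) = y * I) :
    ∃ r : ℝ, 0 < r ∧ E₄ τ = r := by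
  refine ⟨1 + 240 * ∑' k : ℕ+, (ArithmeticFunction.sigma 3 k : ℝ) *
    Real.exp (-2 * Real.pi * y) ^ (k : ℕ), ?_, ?_⟩
  · have : 0 ≤ ∑' k : ℕ+, (ArithmeticFunction.sigma 3 k : ℝ) *
      Real.exp (-2 * Real.pi * y) ^ (k : ℕ) := tsum_nonneg fun _ ↦ by positivity
    positivity
  · have h := EisensteinSeries.q_expansion_bernoulli (by norm_num : 3 ≤ 4) ⟨2, rfl⟩ τ
    rw [show bernoulli 4 = -1 / 30 by norm_num [bernoulli, bernoulli'_four]] at h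
    rw [h, hτ, exp_two_pi_I_mul_I]
    push_cast
    norm_num

/-- The eta product is real for real `q`, so `Δ` is the 24th power of a real number, and it never
vanishes. -/
theorem exists_discriminant_eq_ofReal_pos {τ : ℍ} {y : ℝ} (hτ : (τ : ℂ) = y * I) :
    ∃ r : ℝ, 0 < r ∧ discriminant τ = r := by
  have hm := multipliableLocallyUniformlyOn_eta.multipliable τ.2
  have hprod : (starRingEnd ℂ) (∏' k, (1 - eta_q k τ)) = ∏' k, (1 - eta_q k τ) := by
    rw [hm.map_tprod (starRingEnd ℂ) continuous_conj]
    refine tprod_congr fun k ↦ ?_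
    rw [eta_q_eq_pow, hτ, exp_two_pi_I_mul_I, map_sub, map_one, map_pow, conj_ofReal]
  obtain ⟨s, hs⟩ := conj_eq_iff_real.1 hprod
  have hq : Function.Periodic.qParam 24 (τ : ℂ) = (Real.exp (-2 * Real.pi * y / 24) : ℝ) := by
    rw [Function.Periodic.qParam, ofReal_exp, hτ]
    congr 1
    push_cast
    linear_combination (2 * Real.pi * y / 24 : ℂ) * I_sq
  have heta : discriminant τ = ((Real.exp (-2 * Real.pi * y / 24) * s) ^ 24 : ℝ) := by
    rw [discriminant, ModularForm.eta, hs, hq]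
    push_cast
    rfl
  refine ⟨_, lt_of_le_of_ne (Even.pow_nonneg ⟨12, rfl⟩ _) fun h ↦ ?_, heta⟩
  exact discriminant_ne_zero τ (by rw [heta, ← h, ofReal_zero])

/-- Forms of weight `4 k` with `k ≤ 2` are multiples of `E₄ ^ k`. -/
theorem exists_eq_smul_E₄_pow {k : ℕ} (hk : k ≤ 2) (g : ModularForm 𝒮ℒ ((4 * k : ℕ) : ℤ)) :
    ∃ c : ℂ, ∀ τ, g τ = c * E₄ τ ^ k := by
  have hrank : Module.rank ℂ (ModularForm 𝒮ℒ ((4 * k : ℕ) : ℤ)) = 1 := by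
    rw [dimension_level_one (4 * k) ⟨2 * k, by ring⟩]
    interval_cases k <;> simp [Nat.ModEq]
  let e : ModularForm 𝒮ℒ ((4 * k : ℕ) : ℤ) := (E₄.pow k).mcast (by push_cast; ring)
  have he (τ : ℍ) : e τ = E₄ τ ^ k := by
    change (E₄.pow k) τ = _
    rw [coe_pow]
    rfl
  have he0 : e ≠ 0 := fun h ↦ by
    obtain ⟨r, hr, hr'⟩ := exists_E₄_eq_ofReal_pos (τ := UpperHalfPlane.I) (y := 1) (by simp)
    have := he UpperHalfPlane.I
    rw [h, hr'] at this
    exact pow_ne_zero k (ofReal_ne_zero.2 hr.ne') this.symm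
  obtain ⟨c, hc⟩ := (finrank_eq_one_iff_of_nonzero' e he0).1
    (Module.rank_eq_one_iff_finrank_eq_one.1 hrank) g
  exact ⟨c, fun τ ↦ by rw [← hc, ← he]; rfl⟩

end ImaginaryAxis

end SecrecyGain

namespace SecrecyGain

open Filter Topology Complex Asymptotics MatrixGroups ModularForm

open UpperHalfPlane hiding I

/-! ### The lattice `ℤⁿ` -/

section IntegerLattice

variable (n : ℕ)

instance : DiscreteTopology (intLattice n) := by
  unfold intLattice
  infer_instance

instance : IsZLattice ℝ (intLattice n) := by
  unfold intLattice
  infer_instance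

theorem covolume_intLattice : ZLattice.covolume (intLattice n) = 1 := by
  rw [ZLattice.covolume_eq_measure_fundamentalDomain (intLattice n) MeasureTheory.volume
    (ZSpan.isAddFundamentalDomain (EuclideanSpace.basisFun (Fin n) ℝ).toBasis _),
    volume_real_fundamentalDomain_basisFun]

variable {n}

theorem exists_coord_eq_int {x : EuclideanSpace ℝ (Fin n)} (hx : x ∈ intLattice n) (i : Fin n) :
    ∃ a : ℤ, x i = (a : ℝ) := by
  classical
  induction hx using Submodule.span_induction with
  | mem x h =>
    obtain ⟨j, rfl⟩ := h
    refine ⟨if i = j then 1 else 0, ?_⟩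
    simp
  | zero => exact ⟨0, by simp⟩
  | add x y _ _ hx hy =>
    obtain ⟨a, ha⟩ := hx
    obtain ⟨b, hb⟩ := hy
    exact ⟨a + b, by simp [ha, hb]⟩
  | smul c x _ hx =>
    obtain ⟨a, ha⟩ := hx
    exact ⟨c * a, by simp [ha]⟩

theorem exists_inner_eq_int_of_mem_intLattice {x y : EuclideanSpace ℝ (Fin n)}
    (hx : x ∈ intLattice n) (hy : y ∈ intLattice n) : ∃ a : ℤ, inner ℝ x y = (a : ℝ) := by
  choose a ha using exists_coord_eq_int hx
  choose b hb using exists_coord_eq_int hy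
  exact ⟨∑ i, b i * a i, by simp [PiLp.inner_apply, ha, hb]⟩

theorem one_le_norm_sq_of_mem_intLattice {x : EuclideanSpace ℝ (Fin n)} (hx : x ∈ intLattice n)
    (hx0 : x ≠ 0) : 1 ≤ ‖x‖ ^ 2 := by
  obtain ⟨a, ha⟩ := exists_inner_eq_int_of_mem_intLattice hx hx
  rw [real_inner_self_eq_norm_sq] at ha
  have h : 0 < ‖x‖ ^ 2 := by positivity
  rw [ha] at h ⊢
  exact_mod_cast h

theorem basisFun_mem_intLattice (i : Fin n) : EuclideanSpace.basisFun (Fin n) ℝ i ∈ intLattice n :=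
  Submodule.subset_span ⟨i, by simp⟩

end IntegerLattice

/-- Supplies a height at which a gap of one between norms outweighs the constant of a tail bound. -/
theorem exists_one_le_lt_exp (A : ℝ) : ∃ y : ℝ, 1 ≤ y ∧ A < Real.exp (Real.pi * y) := by
  have h : Tendsto (fun y : ℝ ↦ Real.exp (Real.pi * y)) atTop atTop :=
    Real.tendsto_exp_atTop.comp (tendsto_id.const_mul_atTop Real.pi_pos)
  exact ((eventually_ge_atTop 1).and (h.eventually_gt_atTop A)).exists

/-! ### Existence of the secrecy gain -/

section SecrecyGain

variable {n : ℕ} {L : Submodule ℤ (EuclideanSpace ℝ (Fin n))}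

theorem IsEven.two_le_norm_sq (hL : IsEven L) {x : EuclideanSpace ℝ (Fin n)} (hx : x ∈ L)
    (hx0 : x ≠ 0) : 2 ≤ ‖x‖ ^ 2 := by
  obtain ⟨a, ha⟩ := hL x hx
  have h : 0 < ‖x‖ ^ 2 := by positivity
  rw [ha] at h ⊢
  have : (1 : ℤ) ≤ a := by
    have : (0 : ℝ) < a := by linarith
    exact_mod_cast this
  have : (1 : ℝ) ≤ a := by exact_mod_cast this
  linarith

variable [DiscreteTopology L]

theorem tendsto_realTheta_atTop {r : ℝ} (hr0 : 0 < r) (hr : ∀ x ∈ L, x ≠ 0 → r ≤ ‖x‖ ^ 2) :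
    Tendsto (realTheta L) atTop (𝓝 1) := by
  have h : Tendsto (fun y ↦ Real.exp (-(Real.pi * r * (y - 1))) * realTheta L 1) atTop (𝓝 0) := by
    have h1 : Tendsto (fun y : ℝ ↦ Real.pi * r * (y - 1)) atTop atTop :=
      (tendsto_atTop_add_const_right _ (-1) tendsto_id).const_mul_atTop (by positivity)
    simpa using (Real.tendsto_exp_neg_atTop_nhds_zero.comp h1).mul_const (realTheta L 1)
  rw [tendsto_iff_norm_sub_tendsto_zero]
  refine squeeze_zero' (Eventually.of_forall fun _ ↦ norm_nonneg _) ?_ h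
  filter_upwards [eventually_ge_atTop 1] with y hy
  exact abs_realTheta_sub_one_le L hr hy

theorem continuousOn_secrecyFunction : ContinuousOn (secrecyFunction L) (Set.Ioi 0) := by
  simp only [funext (secrecyFunction_eq L)]
  exact (continuousOn_realTheta _).div (continuousOn_realTheta _) fun y hy ↦
    (zero_lt_one.trans_le (one_le_realTheta L hy)).ne'

theorem tendsto_secrecyFunction_atTop (hLe : IsEven L) :
    Tendsto (secrecyFunction L) atTop (𝓝 1) := by
  simp only [funext (secrecyFunction_eq L)]
  simpa [Pi.div_def] using (tendsto_realTheta_atTop one_pos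
    fun x hx hx0 ↦ one_le_norm_sq_of_mem_intLattice hx hx0).div
    (tendsto_realTheta_atTop two_pos fun x hx hx0 ↦ hLe.two_le_norm_sq hx hx0) one_ne_zero

/-- A unit vector makes the numerator at least `1 + exp (-π y)`, while evenness makes the
denominator `1 + O(exp (-2 π y))`. -/
theorem exists_one_lt_secrecyFunction (hLe : IsEven L) (hn : 0 < n) :
    ∃ y : ℝ, 1 ≤ y ∧ 1 < secrecyFunction L y := by
  obtain ⟨y, hy, hA⟩ := exists_one_le_lt_exp (Real.exp (2 * Real.pi) * realTheta L 1)
  have hy0 : 0 < y := by linarith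
  refine ⟨y, hy, ?_⟩
  rw [secrecyFunction_eq, one_lt_div (zero_lt_one.trans_le (one_le_realTheta L hy0))]
  have h1 := one_add_exp_le_realTheta (intLattice n) hy0 (basisFun_mem_intLattice ⟨0, hn⟩)
    (norm_ne_zero_iff.1 (by simp))
  have h2 := abs_le.1 (abs_realTheta_sub_one_le L (fun x hx hx0 ↦ hLe.two_le_norm_sq hx hx0) hy)
  rw [OrthonormalBasis.norm_eq_one, one_pow, mul_one] at h1
  have h3 : Real.exp (-(Real.pi * 2 * (y - 1))) * realTheta L 1 < Real.exp (-Real.pi * y) := by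
    calc Real.exp (-(Real.pi * 2 * (y - 1))) * realTheta L 1
        = Real.exp (-2 * Real.pi * y) * (Real.exp (2 * Real.pi) * realTheta L 1) := by
          rw [← mul_assoc, ← Real.exp_add]
          ring_nf
      _ < Real.exp (-2 * Real.pi * y) * Real.exp (Real.pi * y) := by gcongr
      _ = Real.exp (-Real.pi * y) := by
          rw [← Real.exp_add]
          ring_nf
  linarith [h2.2]

variable [IsZLattice ℝ L]

/-- Numerator and denominator acquire the same factor `y ^ (-n / 2)` under inversion. -/
theorem secrecyFunction_inv (hL : IsUnimodular L) (hLe : IsEven L) {y : ℝ} (hy : 0 < y) :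
    secrecyFunction L y = secrecyFunction L y⁻¹ := by
  rw [secrecyFunction_eq, secrecyFunction_eq,
    realTheta_inv hL.covolume_eq_one (fun x hx y hy ↦ exists_inner_eq_int hLe hx hy) hy,
    realTheta_inv (covolume_intLattice n)
      (fun x hx y hy ↦ exists_inner_eq_int_of_mem_intLattice hx hy) hy,
    mul_div_mul_left _ _ (Real.rpow_pos_of_pos (inv_pos.2 hy) _).ne']

/-- The secrecy gain of an even unimodular lattice exists. -/
theorem exists_isSecrecyGain (hL : IsUnimodular L) (hLe : IsEven L) (hn : 0 < n) :
    ∃ χ, IsSecrecyGain L χ := by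
  obtain ⟨y₀, hy₀, h₀⟩ := exists_one_lt_secrecyFunction hLe hn
  -- Beyond `R` the function stays below its value at `y₀`, so the maximum over a compact interval
  -- is the maximum over `[1, ∞)`; inversion covers `(0, 1]`.
  obtain ⟨R, hR⟩ := eventually_atTop.1
    ((tendsto_secrecyFunction_atTop hLe).eventually (gt_mem_nhds h₀))
  have hsub : Set.Icc 1 (max R y₀) ⊆ Set.Ioi (0 : ℝ) := fun y hy ↦ zero_lt_one.trans_le hy.1
  have hmem : y₀ ∈ Set.Icc 1 (max R y₀) := ⟨hy₀, le_max_right _ _⟩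
  obtain ⟨y₁, hy₁, hmax⟩ := isCompact_Icc.exists_isMaxOn ⟨y₀, hmem⟩
    (continuousOn_secrecyFunction (L := L) |>.mono hsub)
  have hge (y : ℝ) (hy : 1 ≤ y) : secrecyFunction L y ≤ secrecyFunction L y₁ := by
    rcases le_total y (max R y₀) with h | h
    · exact hmax ⟨hy, h⟩
    · exact (hR y ((le_max_left _ _).trans h)).le.trans (hmax hmem)
  refine ⟨secrecyFunction L y₁, ⟨y₁, hsub hy₁, rfl⟩, ?_⟩
  rintro _ ⟨y, hy, rfl⟩
  rcases le_total 1 y with h | h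
  · exact hge y h
  · rw [secrecyFunction_inv hL hLe hy]
    exact hge _ ((one_le_inv₀ hy).2 h)

end SecrecyGain

/-! ### Comparison of the two theta series -/

section Comparison

variable {n m k : ℕ} {Λ Λ' : Submodule ℤ (EuclideanSpace ℝ (Fin n))}
  [DiscreteTopology Λ] [DiscreteTopology Λ']

/-- The single term of `v` beats the whole tail of `Λ`, which is `O(exp (-π (2 m + 2) y))`. This
determines the sign of `c`. -/
theorem exists_realTheta_lt (hΛ : ∀ x ∈ Λ, x ≠ 0 → 2 * (m : ℝ) + 2 ≤ ‖x‖ ^ 2)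
    {v : EuclideanSpace ℝ (Fin n)} (hv : v ∈ Λ') (hv0 : v ≠ 0) (hvm : ‖v‖ ^ 2 = 2 * m) :
    ∃ y, 1 ≤ y ∧ realTheta Λ y < realTheta Λ' y := by
  obtain ⟨y, hy, hA⟩ := exists_one_le_lt_exp (Real.exp (Real.pi * (2 * m + 2)) * realTheta Λ 1)
  have hy0 : 0 < y := by linarith
  refine ⟨y, hy, ?_⟩
  have h1 := one_add_exp_le_realTheta Λ' hy0 hv hv0
  have h2 := abs_le.1 (abs_realTheta_sub_one_le Λ hΛ hy)
  rw [hvm] at h1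
  have h3 : Real.exp (-(Real.pi * (2 * m + 2) * (y - 1))) * realTheta Λ 1 <
      Real.exp (-Real.pi * y * (2 * m)) := by
    calc Real.exp (-(Real.pi * (2 * m + 2) * (y - 1))) * realTheta Λ 1
        = Real.exp (-(Real.pi * (2 * m + 2) * y)) *
            (Real.exp (Real.pi * (2 * m + 2)) * realTheta Λ 1) := by
          rw [← mul_assoc, ← Real.exp_add]
          ring_nf
      _ < Real.exp (-(Real.pi * (2 * m + 2) * y)) * Real.exp (Real.pi * y) := by gcongr
      _ ≤ Real.exp (-Real.pi * y * (2 * m)) := by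
          rw [← Real.exp_add, Real.exp_le_exp]
          nlinarith [mul_pos Real.pi_pos hy0]
  linarith [h2.2]

variable [IsZLattice ℝ Λ] [IsZLattice ℝ Λ']

/-- The theta series of two even unimodular lattices without nonzero vectors shorter than `2 m`
differ by a multiple of `Δ ^ m * E₄ ^ k`. -/
theorem exists_theta_sub_theta_eq (hk : k ≤ 2) (hn : n = 24 * m + 8 * k)
    (hΛ : IsUnimodular Λ) (hΛe : IsEven Λ) (hΛ' : IsUnimodular Λ') (hΛe' : IsEven Λ')
    (hr : ∀ x ∈ Λ, x ≠ 0 → 2 * (m : ℝ) ≤ ‖x‖ ^ 2) (hr' : ∀ x ∈ Λ', x ≠ 0 → 2 * (m : ℝ) ≤ ‖x‖ ^ 2) :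
    ∃ c : ℂ, ∀ τ : ℍ, theta Λ' τ - theta Λ τ = c * (discriminant τ ^ m * E₄ τ ^ k) := by
  have hn' : n = 8 * (3 * m + k) := by omega
  let D : ModularForm 𝒮ℒ (((4 * k : ℕ) : ℤ) + 12 * m) :=
    (thetaForm hΛ' hΛe' hn' - thetaForm hΛ hΛe hn').mcast (by push_cast; ring)
  have hD (τ : ℍ) : D τ = theta Λ' τ - theta Λ τ := rfl
  -- The constant terms `1` cancel, which leaves a form that is `O(q ^ m)`.
  obtain ⟨g, hg⟩ := exists_eq_discriminant_pow_mul m D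
    (((theta_sub_one_isBigO hr').sub (theta_sub_one_isBigO hr)).congr_left fun τ ↦ by
      rw [hD]; ring)
  obtain ⟨c, hc⟩ := exists_eq_smul_E₄_pow hk g
  exact ⟨c, fun τ ↦ by rw [← hD, hg, hc]; ring⟩

/-- At each height the difference is `c` times a positive real, so positivity at one height gives `c
> 0` and positivity at all. -/
theorem realTheta_lt_realTheta (hk : k ≤ 2) (hn : n = 24 * m + 8 * k)
    (hΛ : IsUnimodular Λ) (hΛe : IsEven Λ) (hΛ' : IsUnimodular Λ') (hΛe' : IsEven Λ')
    (hr : ∀ x ∈ Λ, x ≠ 0 → 2 * (m : ℝ) + 2 ≤ ‖x‖ ^ 2) (hs : HasShortestLength Λ' (2 * (m : ℝ)))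
    {y : ℝ} (hy : 0 < y) : realTheta Λ y < realTheta Λ' y := by
  obtain ⟨⟨v, hv, hv0, hvm⟩, hmin⟩ := hs
  obtain ⟨c, hc⟩ := exists_theta_sub_theta_eq hk hn hΛ hΛe hΛ' hΛe'
    (fun x hx hx0 ↦ by linarith [hr x hx hx0]) fun x hx hx0 ↦ hmin ⟨x, hx, hx0, rfl⟩
  have key (t : ℝ) (ht : 0 < t) :
      ∃ s : ℝ, 0 < s ∧ ((realTheta Λ' t - realTheta Λ t : ℝ) : ℂ) = c * s := by
    let τ : ℍ := ⟨t * I, by simpa using ht⟩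
    have hτ : (τ : ℂ) = t * I := rfl
    obtain ⟨δ, hδ, hδ'⟩ := exists_discriminant_eq_ofReal_pos hτ
    obtain ⟨ε, hε, hε'⟩ := exists_E₄_eq_ofReal_pos hτ
    refine ⟨δ ^ m * ε ^ k, by positivity, ?_⟩
    have h := hc τ
    rw [hδ', hε', hτ, theta_mul_I_eq, theta_mul_I_eq] at h
    push_cast
    exact h
  obtain ⟨t, ht, hlt⟩ := exists_realTheta_lt hr hv hv0 hvm
  obtain ⟨s, hs, hst⟩ := key t (by linarith)
  obtain ⟨u, hu, huy⟩ := key y hy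
  have hc' : c = (((realTheta Λ' t - realTheta Λ t) / s : ℝ) : ℂ) := by
    rw [ofReal_div, hst, mul_div_cancel_right₀ _ (ofReal_ne_zero.2 hs.ne')]
  rw [hc', ← ofReal_mul, ofReal_inj] at huy
  have : 0 < (realTheta Λ' t - realTheta Λ t) / s * u := by
    have := sub_pos.2 hlt
    positivity
  linarith

end Comparison

end SecrecyGain

end

theorem mainTheorem2 (m k n : ℕ) (hk : k ∈ ({0, 1, 2} : Set ℕ)) (hn : n = 24 * m + 8 * k)
    (Λ Λ' : Submodule ℤ (EuclideanSpace ℝ (Fin n)))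
    [DiscreteTopology Λ] [IsZLattice ℝ Λ] [DiscreteTopology Λ'] [IsZLattice ℝ Λ']
    (hΛ : SecrecyGain.IsUnimodular Λ) (hΛ_even : SecrecyGain.IsEven Λ)
    (hΛ_extremal : SecrecyGain.IsExtremal Λ)
    (hΛ' : SecrecyGain.IsUnimodular Λ') (hΛ'_even : SecrecyGain.IsEven Λ')
    (hΛ'_shortest : SecrecyGain.HasShortestLength Λ' (2 * (m : ℝ))) :
    ∃ χ χ' : ℝ, SecrecyGain.IsSecrecyGain Λ χ ∧ SecrecyGain.IsSecrecyGain Λ' χ' ∧ χ' < χ := by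
  have hk2 : k ≤ 2 := by
    simp only [Set.mem_insert_iff, Set.mem_singleton_iff] at hk
    omega
  have hn0 : 0 < n := by
    obtain ⟨v, -, hv0, -⟩ := hΛ'_shortest.1
    rcases Nat.eq_zero_or_pos n with rfl | h
    · exact absurd (Subsingleton.elim v 0) hv0
    · exact h
  have hr : ∀ x ∈ Λ, x ≠ 0 → 2 * (m : ℝ) + 2 ≤ ‖x‖ ^ 2 := fun x hx hx0 ↦ by
    have h := hΛ_extremal.2 ⟨x, hx, hx0, rfl⟩
    have hm : n / 24 = m := by omega
    rw [hm] at h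
    exact_mod_cast h
  obtain ⟨χ, hχ⟩ := SecrecyGain.exists_isSecrecyGain hΛ hΛ_even hn0
  obtain ⟨χ', hχ'⟩ := SecrecyGain.exists_isSecrecyGain hΛ' hΛ'_even hn0
  refine ⟨χ, χ', hχ, hχ', ?_⟩
  -- Compare at a maximiser `y` for `Λ'`: the value for `Λ` there is larger, and is at most `χ`.
  obtain ⟨y, hy, rfl⟩ := hχ'.1
  refine lt_of_lt_of_le ?_ (hχ.2 ⟨y, hy, rfl⟩)
  have hy : 0 < y := hy
  rw [SecrecyGain.secrecyFunction_eq, SecrecyGain.secrecyFunction_eq]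
  have h1 := SecrecyGain.one_le_realTheta Λ hy
  have h2 := SecrecyGain.one_le_realTheta (SecrecyGain.intLattice n) hy
  exact div_lt_div_of_pos_left (by linarith) (by linarith)
    (SecrecyGain.realTheta_lt_realTheta hk2 hn hΛ hΛ_even hΛ' hΛ'_even hr hΛ'_shortest hy)
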